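/- Let $d\ge 1$ be an integer, $1<r<\infty$ and $s\ge 0$ with $\frac1r+\frac sd=\frac12$. Write $\hat f(\xi)=\int_{\mathbb R^d}e^{-2\pi i x\cdot\xi}f(x)\,dx$ for the Fourier transform, extended to tempered distributions. Let $\psi:\mathbb R^d\to\mathbb R$ be either the sharp cut-off $\psi=1_{\{1\le|\xi|\le2\}}$, or a smooth cut-off $\psi(\xi)=\eta(\xi)-\eta(2\xi)$, where $\eta\in C^\infty(\mathbb R^d;\mathbb R)$ satisfies $\eta(\xi)=1$ for $|\xi|\le1$ and $\eta(\xi)=0$ for $|\xi|\ge2$. Then there is a constant $C<\infty$, depending only on $d,r,s$ and $\psi$, such that the following holds. Let $f\in\dot H^s(\mathbb R^d)$, that is, $f$ is a complex-valued tempered distribution whose Fourier transform $\hat f$ is a function with $$\|D^sf\|_{L^2}:=\big\||\xi|^s\hat f\big\|_{L^2_\xi}<\infty,$$ and for $k\in\mathbb Z$ let $f_k$ be its Littlewood–Paley piece, defined by $\hat f_k(\xi)=\psi(2^{-k}\xi)\hat f(\xi)$. Then $f$ is a function in $L^r(\mathbb R^d)$ and $$\|f\|_{L^r}\le C\,\|D^sf\|_{L^2}^{1-2s/d}\,\Big(\sup_{k\in\mathbb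 Z}\|f_k\|_{L^r}\Big)^{2s/d},$$ where a zeroth power is read as $1$. -/

import Mathlib

open MeasureTheory FourierTransform
open scoped SchwartzMap ENNReal NNReal ContDiff

/-- The tempered distribution `T` on `ℝ^d` is (integration against) the function `g`.
Applying the integrability clause to a Gaussian shows that `g` is a.e. strongly measurable and
locally integrable. -/
def IsRepresentedBy {d : ℕ} (T : 𝓢'(EuclideanSpace ℝ (Fin d), ℂ))
    (g : EuclideanSpace ℝ (Fin d) → ℂ) : Prop :=
  ∀ φ : 𝓢(EuclideanSpace ℝ (Fin d), ℂ),
    Integrable (fun x => φ x * g x) ∧ T φ = ∫ x, φ x * g x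

/-- `‖D^s f‖_{L²} = ‖ |ξ|^s f̂ ‖_{L²}`, in terms of the Fourier transform `f̂` of `f`. -/
noncomputable def homSobolevNorm {d : ℕ} (s : ℝ) (fhat : EuclideanSpace ℝ (Fin d) → ℂ) : ℝ≥0∞ :=
  eLpNorm (fun ξ => ((‖ξ‖ ^ s : ℝ) : ℂ) * fhat ξ) 2 volume

/-- The sharp cut-off `1_{1 ≤ |ξ| ≤ 2}`. -/
noncomputable def sharpCutoff (d : ℕ) : EuclideanSpace ℝ (Fin d) → ℝ :=
  Set.indicator {ξ | 1 ≤ ‖ξ‖ ∧ ‖ξ‖ ≤ 2} (fun _ => 1)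

/-- `ψ(ξ) = η(ξ) - η(2ξ)` for a smooth `η` equal to `1` on `|ξ| ≤ 1` and to `0` on `|ξ| ≥ 2`. -/
def IsSmoothCutoff {d : ℕ} (ψ : EuclideanSpace ℝ (Fin d) → ℝ) : Prop :=
  ∃ η : EuclideanSpace ℝ (Fin d) → ℝ, ContDiff ℝ ∞ η ∧
    (∀ ξ, ‖ξ‖ ≤ 1 → η ξ = 1) ∧ (∀ ξ, 2 ≤ ‖ξ‖ → η ξ = 0) ∧
    ∀ ξ, ψ ξ = η ξ - η ((2 : ℝ) • ξ)

/-- The `k`-th Littlewood–Paley piece `f_k` with `f̂_k(ξ) = ψ(2^{-k} ξ) f̂(ξ)`, in terms of the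
Fourier transform `f̂` of `f`. -/
noncomputable def lpPiece {d : ℕ} (ψ : EuclideanSpace ℝ (Fin d) → ℝ)
    (fhat : EuclideanSpace ℝ (Fin d) → ℂ) (k : ℤ) : EuclideanSpace ℝ (Fin d) → ℂ :=
  𝓕⁻ (fun ξ => ((ψ (((2 : ℝ) ^ (-k)) • ξ) : ℝ) : ℂ) * fhat ξ)

/-!
The function `f` is split at every dyadic frequency `2 ^ K` into a low-frequency part `u_K`, with
Fourier transform `lowFreq`, and a high-frequency part `v_K`, with Fourier transform `highFreq`. The
first Fourier transform is integrable and the second is square integrable, so both parts are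
functions. All the sums `u_K + v_K` represent `f`, hence they agree almost everywhere with one
function `F` (`IsLowCutoff.exists_isRepresentedBy`).

Both kinds of cut-off have the form `ψ ξ = m ξ - m (2 ξ)` up to null sets, where `m` is a smooth
`η` or the indicator function of `‖ξ‖ ≤ 2`. The pieces `f_k` therefore telescope to `u_K`. If
`‖f_k‖_∞ ≤ t * 2 ^ (k d / r)` for all `k`, a geometric series gives
`‖u_K‖_∞ ≤ c * t * 2 ^ (K d / r)` (`IsLowCutoff.norm_fourierInv_lowFreq_le`). At a point where
`‖F‖` is comparable to, and at least twice, this last number, `‖F‖ ≤ 2 * ‖v_K‖`. Every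
point with `F ≠ 0` is of this kind for some `K`, so
`‖F‖ ^ r ≲ ∑ K, (t * 2 ^ (K d / r)) ^ (r - 2) * ‖v_K‖ ^ 2`
(`enorm_rpow_le_tsum_of_forall_eq_add`). Integrate and apply Plancherel's theorem to each `v_K`.
Since `(r - 2) d / r = 2 s`, and a frequency `ξ` contributes to `v_K` only for `2 ^ K < ‖ξ‖`,
summing the geometric series over `K` at each `ξ` yields
`‖F‖_r ^ r ≲ t ^ (r - 2) * ‖D^s f‖_2 ^ 2` (`IsLowCutoff.lintegral_rpow_le`).

It remains to choose `t`. Cauchy–Schwarz allows a multiple of `‖D^s f‖_2`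
(`IsLowCutoff.enorm_lpPiece_le_homSobolevNorm`), which gives `F ∈ L^r`. Bernstein's inequality
allows any positive number above a multiple of `sup_k ‖f_k‖_r` (`IsLowCutoff.exists_enorm_lpPiece_le`),
which gives the stated bound. For `s = 0` the exponent `r` is `2` and the geometric series over `K`
diverges, but the claim is then Plancherel's theorem.
-/

open Filter Topology

/-! ### Distributions represented by functions and the Fourier transform -/

/-- Testing against bump functions gives local integrability. -/
theorem IsRepresentedBy.locallyIntegrable {d : ℕ} {T : 𝓢'(EuclideanSpace ℝ (Fin d), ℂ)}
    {g : EuclideanSpace ℝ (Fin d) → ℂ} (h : IsRepresentedBy T g) :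
    LocallyIntegrable g volume := by
  intro x
  let b : ContDiffBump x := ⟨1, 2, by norm_num, by norm_num⟩
  have hc : HasCompactSupport (fun y => ((b y : ℝ) : ℂ)) :=
    b.hasCompactSupport.comp_left (g := fun t : ℝ => (t : ℂ)) (by simp)
  have hd : ContDiff ℝ ∞ (fun y => ((b y : ℝ) : ℂ)) :=
    Complex.ofRealCLM.contDiff.comp b.contDiff
  have h1 := (h (hc.toSchwartzMap hd)).1
  refine ⟨Metric.closedBall x 1, Metric.closedBall_mem_nhds x one_pos, ?_⟩
  refine (h1.integrableOn (s := Metric.closedBall x 1)).congr_fun ?_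
    Metric.isClosed_closedBall.measurableSet
  intro y hy
  have : b y = 1 := b.one_of_mem_closedBall hy
  simp [this]

theorem IsRepresentedBy.ae_eq {d : ℕ} {T : 𝓢'(EuclideanSpace ℝ (Fin d), ℂ)}
    {g g' : EuclideanSpace ℝ (Fin d) → ℂ} (h : IsRepresentedBy T g) (h' : IsRepresentedBy T g') :
    g =ᵐ[volume] g' := by
  refine ae_eq_of_integral_contDiff_smul_eq h.locallyIntegrable h'.locallyIntegrable ?_
  intro φ hφ hc
  have hc' : HasCompactSupport (fun y => ((φ y : ℝ) : ℂ)) :=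
    hc.comp_left (g := fun t : ℝ => (t : ℂ)) (by simp)
  have hd : ContDiff ℝ ∞ (fun y => ((φ y : ℝ) : ℂ)) :=
    Complex.ofRealCLM.contDiff.comp hφ
  have h1 := (h (hc'.toSchwartzMap hd)).2
  have h2 := (h' (hc'.toSchwartzMap hd)).2
  simpa using h1.symm.trans h2

section
variable {E : Type*} [NormedAddCommGroup E] [InnerProductSpace ℝ E] [FiniteDimensional ℝ E]
  [MeasurableSpace E] [BorelSpace E]

/-- The multiplication formula for the inverse Fourier transform. -/
theorem integral_fourierInv_mul_eq {u v : E → ℂ} (hu : Integrable u) (hv : Integrable v) :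
    ∫ x, 𝓕⁻ u x * v x = ∫ x, u x * 𝓕⁻ v x := by
  have := VectorFourier.integral_fourierIntegral_smul_eq_flip (μ := volume) (ν := volume)
    (L := - innerₗ E) (e := Real.fourierChar) (f := u) (g := v) Real.continuous_fourierChar
    (continuous_inner (𝕜 := ℝ) (E := E)).neg hu hv
  simp only [smul_eq_mul] at this
  have hflip : (-innerₗ E).flip = -innerₗ E := by
    ext x y
    simp [real_inner_comm]
  rw [hflip] at this
  exact this

theorem norm_fourierInv_le (v : E → ℂ) (x : E) : ‖𝓕⁻ v x‖ ≤ ∫ ξ, ‖v ξ‖ := by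
  rw [Real.fourierInv_eq]
  refine (norm_integral_le_integral_norm _).trans (le_of_eq ?_)
  simp only [Circle.norm_smul]

theorem continuous_fourierInv {v : E → ℂ} (hv : Integrable v) : Continuous (𝓕⁻ v) := by
  have := VectorFourier.fourierIntegral_continuous (μ := volume) 
    (L := - innerₗ E) (e := Real.fourierChar) Real.continuous_fourierChar
    (continuous_inner (𝕜 := ℝ) (E := E)).neg hv
  exact this

/-- The inverse Fourier transform of a square integrable function, given by Plancherel's theorem,
as a function. -/
noncomputable def fourierInvL2 {v : E → ℂ} (hv : MemLp v 2 volume) : E → ℂ :=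
  (𝓕⁻ (hv.toLp v) : Lp ℂ 2 (volume : Measure E))

theorem memLp_fourierInvL2 {v : E → ℂ} (hv : MemLp v 2 volume) :
    MemLp (fourierInvL2 hv) 2 volume := Lp.memLp _

/-- Plancherel's theorem. -/
theorem eLpNorm_fourierInvL2 {v : E → ℂ} (hv : MemLp v 2 volume) :
    eLpNorm (fourierInvL2 hv) 2 volume = eLpNorm v 2 volume := by
  have h : ‖(𝓕⁻ (hv.toLp v) : Lp ℂ 2 (volume : Measure E))‖ = ‖hv.toLp v‖ :=
    (Lp.fourierTransformₗᵢ E ℂ).symm.norm_map _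
  rw [fourierInvL2, ← Lp.enorm_def, ← Lp.enorm_toLp (hf := hv), enorm_eq_iff_norm_eq.2 h]

end

/-- If the Fourier transform of `f` is the sum of an integrable and a square integrable function,
then `f` is the sum of the two inverse Fourier transforms. -/
theorem IsRepresentedBy.fourierInv_add {d : ℕ} {f : 𝓢'(EuclideanSpace ℝ (Fin d), ℂ)}
    {g u v : EuclideanSpace ℝ (Fin d) → ℂ} (h : IsRepresentedBy (𝓕 f) g)
    (hu : Integrable u) (hv : MemLp v 2 volume) (hg : ∀ᵐ ξ, g ξ = u ξ + v ξ) :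
    IsRepresentedBy f (fun x => 𝓕⁻ u x +
      fourierInvL2 hv x) := by
  intro φ
  have i1 : Integrable (fun x => φ x * 𝓕⁻ u x) := by
    refine φ.integrable.mul_bdd (c := ∫ ξ, ‖u ξ‖) (continuous_fourierInv hu).aestronglyMeasurable ?_
    exact .of_forall (norm_fourierInv_le u)
  have i2 : Integrable (fun x => φ x *
      fourierInvL2 hv x) :=
    (φ.memLp 2 volume).integrable_mul (memLp_fourierInvL2 hv)
  have j1 : Integrable (fun x => 𝓕⁻ φ x * u x) := by
    refine hu.bdd_mul (c := ∫ ξ, ‖φ ξ‖) ?_ ?_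
    · exact (𝓕⁻ φ).continuous.aestronglyMeasurable
    · refine .of_forall fun x => ?_
      rw [SchwartzMap.fourierInv_coe]
      exact norm_fourierInv_le φ x
  have j2 : Integrable (fun x => 𝓕⁻ φ x * v x) :=
    ((𝓕⁻ φ).memLp 2 volume).integrable_mul hv
  refine ⟨by simpa only [mul_add] using! i1.add i2, ?_⟩
  have e0 : f φ = 𝓕 f (𝓕⁻ φ) := by
    rw [TemperedDistribution.fourier_apply, FourierTransform.fourier_fourierInv_eq]
  have e1 : ∫ x, 𝓕⁻ φ x * g x = ∫ x, (𝓕⁻ φ x * u x + 𝓕⁻ φ x * v x) := by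
    refine integral_congr_ae ?_
    filter_upwards [hg] with x hx
    rw [hx, mul_add]
  have e2 : ∫ x, 𝓕⁻ φ x * u x = ∫ x, φ x * 𝓕⁻ u x := by
    rw [SchwartzMap.fourierInv_coe]
    exact integral_fourierInv_mul_eq φ.integrable hu
  have e3 : ∫ x, 𝓕⁻ φ x * v x =
      ∫ x, φ x * fourierInvL2 hv x := by
    have := congrArg (fun T : 𝓢'(EuclideanSpace ℝ (Fin d), ℂ) => T φ)
      (Lp.fourierInv_toTemperedDistribution_eq (hv.toLp v))
    simp only [TemperedDistribution.fourierInv_apply, Lp.toTemperedDistribution_apply,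
      smul_eq_mul] at this
    rw [fourierInvL2, ← this]
    refine integral_congr_ae ?_
    filter_upwards [hv.coeFn_toLp] with x hx
    rw [hx]
  simp only [mul_add]
  rw [integral_add i1 i2, e0, (h _).2, e1, integral_add j1 j2, e2, e3]

/-! ### Bernstein's inequality -/

section
variable {E : Type*} [NormedAddCommGroup E] [InnerProductSpace ℝ E] [FiniteDimensional ℝ E]
  [MeasurableSpace E] [BorelSpace E]

/-- The reproducing formula behind Bernstein's inequality: a function with Fourier transform `g`
equals its convolution with a rescaled copy of `h` as soon as the rescaled `𝓕 h` is `1` on the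
support of `g`. -/
theorem fourierInv_eq_integral_mul_fourierInv {h g : E → ℂ} (hh : Integrable h)
    (hg : Integrable g) {R : ℝ} (hhg : ∀ ξ, 𝓕 h (R⁻¹ • ξ) * g ξ = g ξ) (x : E) :
    𝓕⁻ g x = ∫ y, h y * 𝓕⁻ g (x - R⁻¹ • y) := by
  have hG : Integrable (fun ξ => Real.fourierChar (inner ℝ ξ x) • g ξ) := by
    have := (VectorFourier.fourierIntegral_convergent_iff (μ := volume) (L := - innerₗ E)
      (e := Real.fourierChar) Real.continuous_fourierChar
      ((continuous_inner (𝕜 := ℝ) (E := E)).neg) (f := g) x).2 hg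
    simpa using! this
  have := VectorFourier.integral_fourierIntegral_smul_eq_flip (μ := volume) (ν := volume)
    (L := R⁻¹ • innerₗ E) (e := Real.fourierChar) (f := h) Real.continuous_fourierChar
    ((continuous_inner (𝕜 := ℝ) (E := E)).const_smul R⁻¹) hh hG
  simp only [smul_eq_mul] at this
  have e1 : ∀ ξ, VectorFourier.fourierIntegral Real.fourierChar volume (R⁻¹ • innerₗ E) h ξ =
      𝓕 h (R⁻¹ • ξ) := by
    intro ξ
    rw [Real.fourier_eq]
    simp [VectorFourier.fourierIntegral, inner_smul_right]
  have e2 : ∀ y, VectorFourier.fourierIntegral Real.fourierChar volume (R⁻¹ • innerₗ E).flip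
      (fun ξ => Real.fourierChar (inner ℝ ξ x) • g ξ) y = 𝓕⁻ g (x - R⁻¹ • y) := by
    intro y
    rw [Real.fourierInv_eq]
    simp only [VectorFourier.fourierIntegral, smul_smul, ← AddChar.map_add_eq_mul]
    congr! 4 with ξ
    simp [inner_sub_right, inner_smul_right, real_inner_comm]
    ring
  simp only [e1, e2] at this
  rw [← this, Real.fourierInv_eq]
  congr! 2 with ξ
  rw [mul_smul_comm, hhg]

theorem lintegral_comp_sub_inv_smul (φ : E → ℝ≥0∞) (hφ : Measurable φ) {R : ℝ} (hR : 0 < R)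
    (x : E) : ∫⁻ y, φ (x - R⁻¹ • y) =
      ENNReal.ofReal (R ^ Module.finrank ℝ E) * ∫⁻ y, φ y := by
  have h1 : ∫⁻ y, φ (x - R⁻¹ • y) =
      ∫⁻ z, φ (x - z) ∂(Measure.map (R⁻¹ • ·) (volume : Measure E)) := by
    rw [lintegral_map (by fun_prop) (by fun_prop)]
  rw [h1, Measure.map_addHaar_smul _ (inv_ne_zero hR.ne'), lintegral_smul_measure,
    lintegral_sub_left_eq_self φ x, smul_eq_mul]
  congr 2
  rw [inv_pow, inv_inv, abs_of_pos (by positivity)]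

/-- Bernstein's inequality. -/
theorem enorm_fourierInv_le_eLpNorm {h g : E → ℂ} (hh : Integrable h)
    (hg : Integrable g) {R : ℝ} (hR : 0 < R) (hhg : ∀ ξ, 𝓕 h (R⁻¹ • ξ) * g ξ = g ξ)
    {p q : ℝ} (hpq : p.HolderConjugate q) (x : E) :
    ‖𝓕⁻ g x‖ₑ ≤ eLpNorm h (ENNReal.ofReal q) volume *
      (ENNReal.ofReal (R ^ Module.finrank ℝ E)) ^ (1 / p) *
        eLpNorm (𝓕⁻ g) (ENNReal.ofReal p) volume := by
  have hp := hpq.pos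
  have hq := hpq.symm.pos
  have hc := continuous_fourierInv hg
  rw [fourierInv_eq_integral_mul_fourierInv hh hg hhg]
  refine (enorm_integral_le_lintegral_enorm _).trans ?_
  simp only [enorm_mul]
  refine (ENNReal.lintegral_mul_le_Lp_mul_Lq volume hpq.symm hh.aestronglyMeasurable.enorm
    ?_).trans ?_
  · exact (hc.comp (by fun_prop : Continuous fun y => x - R⁻¹ • y)).measurable.enorm.aemeasurable
  · rw [lintegral_comp_sub_inv_smul (fun z => ‖𝓕⁻ g z‖ₑ ^ p) (hc.measurable.enorm.pow_const _) hR,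
      ENNReal.mul_rpow_of_nonneg _ _ (by positivity),
      eLpNorm_eq_lintegral_rpow_enorm_toReal (by simpa using hq) ENNReal.ofReal_ne_top,
      eLpNorm_eq_lintegral_rpow_enorm_toReal (by simpa using hp) ENNReal.ofReal_ne_top,
      ENNReal.toReal_ofReal hp.le, ENNReal.toReal_ofReal hq.le, mul_assoc]

end

/-! ### Splitting into low and high frequencies -/

/-- Low-frequency cut-off functions: bounded by `M`, equal to `1` for `‖ξ‖ ≤ 1` and to `0` for
`‖ξ‖ > 2`. This covers both the smooth `η` and the indicator function of `‖ξ‖ ≤ 2`. -/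
structure IsLowCutoff {E : Type*} [NormedAddCommGroup E] [MeasurableSpace E]
    (M : ℝ) (m : E → ℝ) : Prop where
  measurable : Measurable m
  abs_le : ∀ ξ, |m ξ| ≤ M
  eq_one : ∀ ξ, ‖ξ‖ ≤ 1 → m ξ = 1
  eq_zero : ∀ ξ, 2 < ‖ξ‖ → m ξ = 0

theorem IsLowCutoff.nonneg {E : Type*} [NormedAddCommGroup E] [MeasurableSpace E]
    {M : ℝ} {m : E → ℝ} (hm : IsLowCutoff M m) : 0 ≤ M :=
  (abs_nonneg _).trans (hm.abs_le 0)

section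
variable {E : Type*} [NormedAddCommGroup E] [InnerProductSpace ℝ E]

/-- The part of `g` at frequencies `‖ξ‖ ≲ 2 ^ K`. -/
noncomputable def lowFreq (m : E → ℝ) (g : E → ℂ) (K : ℤ) (ξ : E) : ℂ :=
  (m (((2 : ℝ) ^ (-K)) • ξ) : ℂ) * g ξ

/-- The part of `g` at frequencies `‖ξ‖ ≳ 2 ^ K`. -/
noncomputable def highFreq (m : E → ℝ) (g : E → ℂ) (K : ℤ) (ξ : E) : ℂ :=
  (1 - (m (((2 : ℝ) ^ (-K)) • ξ) : ℂ)) * g ξ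

theorem norm_two_zpow_neg_smul (K : ℤ) (ξ : E) : ‖((2 : ℝ) ^ (-K)) • ξ‖ = ‖ξ‖ / 2 ^ K := by
  rw [norm_smul, Real.norm_of_nonneg (by positivity), zpow_neg]; field_simp

variable [MeasurableSpace E] {M : ℝ} {m : E → ℝ} {g : E → ℂ}

theorem IsLowCutoff.lowFreq_eq_zero (hm : IsLowCutoff M m) {K : ℤ} {ξ : E}
    (h : (2 : ℝ) ^ (K + 1) < ‖ξ‖) : lowFreq m g K ξ = 0 := by
  rw [lowFreq, hm.eq_zero, Complex.ofReal_zero, zero_mul]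
  rw [norm_two_zpow_neg_smul, lt_div_iff₀ (by positivity)]
  rwa [zpow_add_one₀ two_ne_zero, mul_comm] at h

theorem IsLowCutoff.norm_lowFreq_le (hm : IsLowCutoff M m) (K : ℤ) (ξ : E) :
    ‖lowFreq m g K ξ‖ ≤ M * ‖g ξ‖ := by
  rw [lowFreq, norm_mul, Complex.norm_real]
  gcongr
  exact hm.abs_le _

theorem IsLowCutoff.highFreq_eq_zero (hm : IsLowCutoff M m) {K : ℤ} {ξ : E}
    (h : ‖ξ‖ ≤ (2 : ℝ) ^ K) : highFreq m g K ξ = 0 := by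
  rw [highFreq, hm.eq_one, Complex.ofReal_one, sub_self, zero_mul]
  rw [norm_two_zpow_neg_smul]
  exact div_le_one_of_le₀ h (by positivity)

theorem IsLowCutoff.norm_highFreq_le (hm : IsLowCutoff M m) (K : ℤ) (ξ : E) :
    ‖highFreq m g K ξ‖ ≤ (1 + M) * ‖g ξ‖ := by
  rw [highFreq, norm_mul]
  gcongr
  refine (norm_sub_le _ _).trans ?_
  rw [Complex.norm_real, norm_one]
  gcongr
  exact hm.abs_le _

variable [BorelSpace E]

theorem IsLowCutoff.measurable_comp_smul (hm : IsLowCutoff M m) (c : ℝ) :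
    Measurable fun ξ => (m (c • ξ) : ℂ) :=
  Complex.measurable_ofReal.comp (hm.measurable.comp (measurable_const_smul c))

variable [FiniteDimensional ℝ E]

theorem IsLowCutoff.integrable_lowFreq (hm : IsLowCutoff M m)
    (hg : LocallyIntegrable g volume) (K : ℤ) : Integrable (lowFreq m g K) := by
  have h1 : IntegrableOn g (Metric.closedBall 0 (2 ^ (K + 1))) :=
    hg.integrableOn_isCompact (isCompact_closedBall _ _)
  have h2 : IntegrableOn (lowFreq m g K) (Metric.closedBall 0 (2 ^ (K + 1))) :=
    Integrable.bdd_mul h1 (c := M) (hm.measurable_comp_smul _).aestronglyMeasurable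
      (.of_forall fun ξ => by rw [Complex.norm_real]; exact hm.abs_le _)
  refine (integrableOn_iff_integrable_of_support_subset ?_).1 h2
  intro ξ hξ
  by_contra h
  exact hξ (hm.lowFreq_eq_zero (by simpa using h))

/-- The inverse Fourier transform of the low-frequency part vanishes in the limit of frequency
zero. -/
theorem IsLowCutoff.tendsto_fourierInv_lowFreq [Nontrivial E] (hm : IsLowCutoff M m)
    (hg : LocallyIntegrable g volume) (K : ℤ) (x : E) :
    Tendsto (fun n : ℕ => 𝓕⁻ (lowFreq m g (K - n)) x) atTop (𝓝 0) := by
  have h1 : IntegrableOn g (Metric.closedBall 0 (2 ^ (K + 1))) :=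
    hg.integrableOn_isCompact (isCompact_closedBall _ _)
  have h2 : Tendsto (fun n : ℕ => ∫ ξ, ‖lowFreq m g (K - n) ξ‖) atTop (𝓝 (∫ ξ : E, (0 : ℝ))) := by
    refine tendsto_integral_of_dominated_convergence
      ((Metric.closedBall 0 (2 ^ (K + 1))).indicator fun ξ => M * ‖g ξ‖) ?_ ?_ ?_ ?_
    · exact fun n => (hm.integrable_lowFreq hg _).norm.aestronglyMeasurable
    · exact (integrable_indicator_iff Metric.isClosed_closedBall.measurableSet).2
        (h1.norm.const_mul M)
    · refine fun n => .of_forall fun ξ => ?_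
      rw [norm_norm]
      by_cases h : ξ ∈ Metric.closedBall (0 : E) (2 ^ (K + 1))
      · rw [Set.indicator_of_mem h]
        exact hm.norm_lowFreq_le _ _
      · rw [Set.indicator_of_notMem h, hm.lowFreq_eq_zero, norm_zero]
        refine lt_of_le_of_lt ?_ (by simpa using h)
        gcongr
        · norm_num
        · omega
    · have : ∀ᵐ ξ : E, ξ ≠ 0 := by simp [ae_iff]
      filter_upwards [this] with ξ hξ
      refine tendsto_const_nhds.congr' ?_
      have hlim : Tendsto (fun n : ℕ => (2 : ℝ) ^ (K + 1) * (1 / 2) ^ n) atTop (𝓝 0) := by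
        simpa using (tendsto_pow_atTop_nhds_zero_of_lt_one (r := (1 / 2 : ℝ))
          (by norm_num) (by norm_num)).const_mul ((2 : ℝ) ^ (K + 1))
      filter_upwards [hlim.eventually_lt_const (norm_pos_iff.2 hξ)] with n hn
      rw [hm.lowFreq_eq_zero, norm_zero]
      refine lt_of_eq_of_lt ?_ hn
      rw [show K - (n : ℤ) + 1 = (K + 1) - n by ring, zpow_sub₀ two_ne_zero, zpow_natCast]
      simp [div_eq_mul_inv]
  rw [integral_zero] at h2
  exact squeeze_zero_norm (fun n => norm_fourierInv_le _ _) h2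

theorem IsLowCutoff.memLp_highFreq (hm : IsLowCutoff M m) (hg : LocallyIntegrable g volume)
    {s : ℝ} (hs : 0 ≤ s)
    (hN : eLpNorm (fun ξ => ((‖ξ‖ ^ s : ℝ) : ℂ) * g ξ) 2 volume < ⊤) (K : ℤ) :
    MemLp (highFreq m g K) 2 volume := by
  have hgm := hg.aestronglyMeasurable
  have h1 : MemLp (fun ξ => ((‖ξ‖ ^ s : ℝ) : ℂ) * g ξ) 2 volume :=
    ⟨(by fun_prop : Measurable fun ξ : E =>
      ((‖ξ‖ ^ s : ℝ) : ℂ)).aestronglyMeasurable.mul hgm, hN⟩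
  refine h1.of_le_mul (c := (1 + M) / ((2 : ℝ) ^ K) ^ s) ?_ (.of_forall fun ξ => ?_)
  · exact (measurable_const.sub (hm.measurable_comp_smul _)).aestronglyMeasurable.mul hgm
  · have hM := hm.nonneg
    rcases le_or_gt ‖ξ‖ ((2 : ℝ) ^ K) with h | h
    · rw [hm.highFreq_eq_zero h, norm_zero]; positivity
    · refine (hm.norm_highFreq_le K ξ).trans ?_
      rw [norm_mul, Complex.norm_real, Real.norm_of_nonneg (by positivity), ← mul_assoc]
      gcongr
      rw [div_mul_eq_mul_div, le_div_iff₀ (by positivity)]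
      gcongr

end

theorem lpPiece_sub_eq {d : ℕ} (m : EuclideanSpace ℝ (Fin d) → ℝ)
    (g : EuclideanSpace ℝ (Fin d) → ℂ) (k : ℤ) :
    lpPiece (fun ξ => m ξ - m ((2 : ℝ) • ξ)) g k = 𝓕⁻ (lowFreq m g k - lowFreq m g (k - 1)) := by
  rw [lpPiece]
  congr 1
  ext ξ
  have : (2 : ℝ) ^ (-(k - 1)) = 2 * 2 ^ (-k) := by
    rw [show -(k - 1) = -k + 1 by ring, zpow_add_one₀ two_ne_zero, mul_comm]
  simp only [lowFreq, Pi.sub_apply, this, smul_smul]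
  push_cast
  ring

/-- The Littlewood–Paley pieces telescope. -/
theorem IsLowCutoff.fourierInv_lowFreq {d : ℕ} {M : ℝ} {m : EuclideanSpace ℝ (Fin d) → ℝ}
    {g : EuclideanSpace ℝ (Fin d) → ℂ} (hm : IsLowCutoff M m)
    (hg : LocallyIntegrable g volume) (k : ℤ) (x : EuclideanSpace ℝ (Fin d)) :
    𝓕⁻ (lowFreq m g k) x =
      𝓕⁻ (lowFreq m g (k - 1)) x + lpPiece (fun ξ => m ξ - m ((2 : ℝ) • ξ)) g k x := by
  have i1 := hm.integrable_lowFreq hg k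
  have i2 := hm.integrable_lowFreq hg (k - 1)
  have h1 : Integrable (lowFreq m g k - lowFreq m g (k - 1)) := i1.sub i2
  rw [lpPiece_sub_eq]
  have h := congrFun (VectorFourier.fourierIntegral_add (μ := volume)
    (L := - innerₗ (EuclideanSpace ℝ (Fin d)))
    (e := Real.fourierChar) Real.continuous_fourierChar
    (continuous_inner (𝕜 := ℝ) (E := EuclideanSpace ℝ (Fin d))).neg i2 h1) x
  rw [add_sub_cancel] at h
  exact h

/-- Summing the geometric series of the pieces bounds the low-frequency part. -/
theorem IsLowCutoff.norm_fourierInv_lowFreq_le {d : ℕ} [NeZero d] {M : ℝ}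
    {m : EuclideanSpace ℝ (Fin d) → ℝ}
    {g : EuclideanSpace ℝ (Fin d) → ℂ} (hm : IsLowCutoff M m)
    (hg : LocallyIntegrable g volume) {a B : ℝ} (ha : 1 < a) (hB : 0 ≤ B)
    {x : EuclideanSpace ℝ (Fin d)}
    (h : ∀ k : ℤ, ‖lpPiece (fun ξ => m ξ - m ((2 : ℝ) • ξ)) g k x‖ ≤ B * a ^ k) (K : ℤ) :
    ‖𝓕⁻ (lowFreq m g K) x‖ ≤ B * (a / (a - 1)) * a ^ K := by
  have ha1 : 0 < a - 1 := sub_pos.2 ha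
  have ha0 : 0 < a := one_pos.trans ha
  have key : ∀ n : ℕ, ‖𝓕⁻ (lowFreq m g K) x‖ ≤
      ‖𝓕⁻ (lowFreq m g (K - n)) x‖ + B * (a / (a - 1)) * (a ^ K - a ^ (K - n)) := by
    intro n
    induction n with
    | zero => simp
    | succ n ih =>
      refine ih.trans ?_
      have h1 := norm_add_le (𝓕⁻ (lowFreq m g (K - n - 1)) x)
        (lpPiece (fun ξ => m ξ - m ((2 : ℝ) • ξ)) g (K - n) x)
      rw [← hm.fourierInv_lowFreq hg] at h1
      have h2 := h (K - n)
      have h3 : a ^ (K - n) = a ^ (K - n - 1) * a := by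
        rw [← zpow_add_one₀ ha0.ne', sub_add_cancel]
      have h4 : B * a ^ (K - n) = B * (a / (a - 1)) * (a ^ (K - n) - a ^ (K - n - 1)) := by
        rw [h3]; field_simp
      rw [show K - ((n + 1 : ℕ) : ℤ) = K - n - 1 by push_cast; ring]
      linarith
  have hlim := (hm.tendsto_fourierInv_lowFreq hg K x).norm.add_const (B * (a / (a - 1)) * a ^ K)
  rw [norm_zero, zero_add] at hlim
  refine ge_of_tendsto' hlim fun n => (key n).trans ?_
  have : 0 ≤ a ^ (K - (n : ℤ)) := by positivity
  gcongr
  linarith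

/-! ### Dyadic sums -/

/-- A geometric series over the dyadic scales below `t` is comparable to its largest term. -/
theorem tsum_zpow_indicator_lt_le {σ : ℝ} (hσ : 0 < σ) {t : ℝ} (ht : 0 ≤ t) :
    ∑' K : ℤ, (if (2 : ℝ) ^ K < t then ENNReal.ofReal ((2 ^ σ) ^ K) else 0) ≤
      (1 - ENNReal.ofReal ((2 ^ σ)⁻¹))⁻¹ * ENNReal.ofReal (t ^ σ) := by
  rcases ht.eq_or_lt with rfl | ht
  · have : ∀ K : ℤ, ¬ (2 : ℝ) ^ K < 0 := fun K => not_lt.2 (by positivity)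
    simp [this]
  obtain ⟨K₀, h1, h2⟩ := exists_mem_Ioc_zpow ht one_lt_two
  have hinj : Function.Injective fun n : ℕ => K₀ - (n : ℤ) := fun a b h => by
    simpa using h
  rw [← hinj.tsum_eq]
  · have hterm : ∀ n : ℕ, (if (2 : ℝ) ^ (K₀ - (n : ℤ)) < t
        then ENNReal.ofReal ((2 ^ σ) ^ (K₀ - (n : ℤ))) else 0) ≤
        ENNReal.ofReal (t ^ σ) * ENNReal.ofReal ((2 ^ σ)⁻¹) ^ n := by
      intro n
      split_ifs
      · rw [← ENNReal.ofReal_pow (by positivity), ← ENNReal.ofReal_mul (by positivity)]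
        apply ENNReal.ofReal_le_ofReal
        rw [zpow_sub₀ (by positivity), zpow_natCast, div_eq_mul_inv, ← inv_pow]
        gcongr
        rw [← Real.rpow_intCast, ← Real.rpow_mul (by norm_num), mul_comm,
          Real.rpow_mul (by norm_num), Real.rpow_intCast]
        gcongr
      · exact zero_le
    refine (ENNReal.tsum_le_tsum hterm).trans ?_
    rw [ENNReal.tsum_mul_left, ENNReal.tsum_geometric, mul_comm]
  · intro K hK
    have hK' : (2 : ℝ) ^ K < t := by
      by_contra h
      exact hK (if_neg h)
    have : K < K₀ + 1 := (zpow_lt_zpow_iff_right₀ (one_lt_two (α := ℝ))).1 (hK'.trans_le h2)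
    exact ⟨(K₀ - K).toNat, by simp only; omega⟩

theorem inv_one_sub_two_rpow_ne_top {σ : ℝ} (hσ : 0 < σ) :
    (1 - ENNReal.ofReal ((2 ^ σ)⁻¹))⁻¹ ≠ ⊤ := by
  rw [ENNReal.inv_ne_top, Ne, tsub_eq_zero_iff_le, not_le, ← ENNReal.ofReal_one,
    ENNReal.ofReal_lt_ofReal_iff one_pos]
  exact inv_lt_one_of_one_lt₀ (Real.one_lt_rpow one_lt_two hσ)

/-- If at each dyadic scale `a ^ K` a number `z` splits into a part of size at most `β * a ^ K`
and a remainder, then `‖z‖ ^ r` is controlled by the remainder at the scale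
`2 * β * a ^ K ≈ ‖z‖`, where it is at least half of `z`. -/
theorem enorm_rpow_le_tsum_of_forall_eq_add {r a β : ℝ} (hr : 2 < r) (ha : 1 < a) (hβ : 0 < β)
    {z : ℂ} {u v : ℤ → ℂ} (hz : ∀ K, z = u K + v K) (hu : ∀ K, ‖u K‖ ≤ β * a ^ K) :
    ‖z‖ₑ ^ r ≤ ∑' K : ℤ, ENNReal.ofReal (4 * (2 * β * a ^ (K + 1)) ^ (r - 2)) * ‖v K‖ₑ ^ 2 := by
  have ha0 : 0 < a := one_pos.trans ha
  rcases eq_or_ne z 0 with rfl | hz0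
  · rw [enorm_zero, ENNReal.zero_rpow_of_pos (by linarith)]
    exact zero_le
  have hzn : 0 < ‖z‖ := norm_pos_iff.2 hz0
  obtain ⟨K, h1, h2⟩ := exists_mem_Ioc_zpow (show 0 < ‖z‖ / (2 * β) by positivity) ha
  rw [lt_div_iff₀ (by positivity)] at h1
  rw [div_le_iff₀ (by positivity)] at h2
  refine le_trans ?_ (ENNReal.le_tsum K)
  have hv : ‖z‖ ≤ 2 * ‖v K‖ := by
    have := norm_add_le (u K) (v K)
    rw [← hz K] at this
    have := hu K
    linarith
  rw [← ofReal_norm, ← ofReal_norm, ENNReal.ofReal_rpow_of_pos hzn,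
    ← ENNReal.ofReal_pow (norm_nonneg _), ← ENNReal.ofReal_mul (by positivity)]
  apply ENNReal.ofReal_le_ofReal
  calc ‖z‖ ^ r = ‖z‖ ^ (r - 2) * ‖z‖ ^ 2 := by
        rw [← Real.rpow_natCast, ← Real.rpow_add hzn]; norm_num
    _ ≤ (2 * β * a ^ (K + 1)) ^ (r - 2) * (2 * ‖v K‖) ^ 2 := by
        gcongr
        linarith
    _ = _ := by ring

section
variable {E : Type*} [NormedAddCommGroup E] [InnerProductSpace ℝ E] [MeasurableSpace E]
  [BorelSpace E] [FiniteDimensional ℝ E]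

theorem eLpNorm_two_sq (v : E → ℂ) : eLpNorm v 2 volume ^ 2 = ∫⁻ x, ‖v x‖ₑ ^ 2 := by
  rw [eLpNorm_eq_lintegral_rpow_enorm_toReal two_ne_zero ENNReal.ofNat_ne_top,
    ← ENNReal.rpow_natCast, ← ENNReal.rpow_mul]
  simp

/-- Summing the high-frequency energies against the weights `(2 ^ (2 * s)) ^ K` recovers the
homogeneous Sobolev norm: the frequency `ξ` enters for `2 ^ K < ‖ξ‖` only. -/
theorem IsLowCutoff.tsum_eLpNorm_highFreq_le {M : ℝ} {m : E → ℝ} {g : E → ℂ}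
    (hm : IsLowCutoff M m) (hg : LocallyIntegrable g volume) {s : ℝ} (hs : 0 < s) :
    ∑' K : ℤ, ENNReal.ofReal ((2 ^ (2 * s)) ^ K) * eLpNorm (highFreq m g K) 2 volume ^ 2 ≤
      ENNReal.ofReal ((1 + M) ^ 2) * (1 - ENNReal.ofReal ((2 ^ (2 * s))⁻¹))⁻¹ *
        eLpNorm (fun ξ => ((‖ξ‖ ^ s : ℝ) : ℂ) * g ξ) 2 volume ^ 2 := by
  have hM := hm.nonneg
  have hgm := hg.aestronglyMeasurable
  have hmeas : ∀ K, AEStronglyMeasurable (highFreq m g K) volume := fun K =>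
    (measurable_const.sub (hm.measurable_comp_smul _)).aestronglyMeasurable.mul hgm
  simp only [eLpNorm_two_sq]
  have hne : ENNReal.ofReal ((1 + M) ^ 2) * (1 - ENNReal.ofReal ((2 ^ (2 * s))⁻¹))⁻¹ ≠ ⊤ :=
    ENNReal.mul_ne_top ENNReal.ofReal_ne_top (inv_one_sub_two_rpow_ne_top (by positivity))
  simp only [← lintegral_const_mul' _ _ ENNReal.ofReal_ne_top]
  rw [← lintegral_tsum fun K => ((hmeas K).enorm.pow_const 2).const_mul _,
    ← lintegral_const_mul' _ _ hne]
  refine lintegral_mono fun ξ => ?_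
  have hterm : ∀ K : ℤ, ENNReal.ofReal ((2 ^ (2 * s)) ^ K) * ‖highFreq m g K ξ‖ₑ ^ 2 ≤
      (if (2 : ℝ) ^ K < ‖ξ‖ then ENNReal.ofReal ((2 ^ (2 * s)) ^ K) else 0) *
        (ENNReal.ofReal ((1 + M) ^ 2) * ‖g ξ‖ₑ ^ 2) := by
    intro K
    split_ifs with h
    · gcongr
      rw [← ofReal_norm, ← ofReal_norm, ← ENNReal.ofReal_pow (norm_nonneg _),
        ← ENNReal.ofReal_pow (norm_nonneg _), ← ENNReal.ofReal_mul (by positivity), ← mul_pow]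
      apply ENNReal.ofReal_le_ofReal
      gcongr
      exact hm.norm_highFreq_le K ξ
    · rw [hm.highFreq_eq_zero (not_lt.1 h)]
      simp
  refine (ENNReal.tsum_le_tsum hterm).trans ?_
  rw [ENNReal.tsum_mul_right]
  refine (mul_le_mul_left (tsum_zpow_indicator_lt_le (by positivity : 0 < 2 * s)
    (norm_nonneg ξ)) _).trans (le_of_eq ?_)
  have : ‖((‖ξ‖ ^ s : ℝ) : ℂ) * g ξ‖ₑ ^ 2 = ENNReal.ofReal (‖ξ‖ ^ (2 * s)) * ‖g ξ‖ₑ ^ 2 := by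
    rw [enorm_mul, mul_pow, ← ofReal_norm, Complex.norm_real,
      Real.norm_of_nonneg (by positivity), ← ENNReal.ofReal_pow (by positivity),
      ← Real.rpow_mul_natCast (norm_nonneg _), mul_comm s]
    simp
  rw [this]
  ring

end

/-! ### Estimates in terms of the sup norms of the pieces -/

/-- The constant of the main estimate; its exact value is irrelevant, see
`sobolevConst_ne_top`. -/
noncomputable def sobolevConst (d : ℕ) (r s M : ℝ) : ℝ≥0∞ :=
  ENNReal.ofReal (4 * (2 * (2 ^ (d / r) / (2 ^ (d / r) - 1)) * 2 ^ (d / r)) ^ (r - 2)) *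
    (ENNReal.ofReal ((1 + M) ^ 2) * (1 - ENNReal.ofReal ((2 ^ (2 * s))⁻¹))⁻¹)

theorem sobolevConst_ne_top {d : ℕ} {r s M : ℝ} (hs : 0 < s) : sobolevConst d r s M ≠ ⊤ :=
  ENNReal.mul_ne_top ENNReal.ofReal_ne_top
    (ENNReal.mul_ne_top ENNReal.ofReal_ne_top (inv_one_sub_two_rpow_ne_top (by positivity)))

/-- The refined Sobolev inequality with the norm of the Besov space `B^{-d/r}_{∞,∞}` in place of
the `L^r` norms of the pieces. -/
theorem IsLowCutoff.lintegral_rpow_le {d : ℕ} [NeZero d] {r s M : ℝ} (hr : 2 < r) (hs : 0 < s)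
    (hrs : 1 / r + s / (d : ℝ) = 1 / 2) {m : EuclideanSpace ℝ (Fin d) → ℝ}
    {F g : EuclideanSpace ℝ (Fin d) → ℂ} (hm : IsLowCutoff M m) (hg : LocallyIntegrable g volume)
    (hv : ∀ K, MemLp (highFreq m g K) 2 volume)
    (hF : ∀ K, F =ᵐ[volume] fun x => 𝓕⁻ (lowFreq m g K) x + fourierInvL2 (hv K) x)
    {t : ℝ≥0∞} (ht0 : t ≠ 0) (ht : t ≠ ⊤)
    (h : ∀ k x, ‖lpPiece (fun ξ => m ξ - m ((2 : ℝ) • ξ)) g k x‖ₑ ≤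
      t * ENNReal.ofReal ((2 ^ ((d : ℝ) / r)) ^ k)) :
    ∫⁻ x, ‖F x‖ₑ ^ r ≤ sobolevConst d r s M * t ^ (r - 2) * homSobolevNorm s g ^ 2 := by
  have hd : (0 : ℝ) < d := Nat.cast_pos.2 (NeZero.pos d)
  have hr0 : 0 < r := by linarith
  set a : ℝ := 2 ^ ((d : ℝ) / r) with ha_def
  have ha : 1 < a := Real.one_lt_rpow one_lt_two (by positivity)
  have ha0 : 0 < a := one_pos.trans ha
  have ha1 : 0 < a - 1 := sub_pos.2 ha
  have hB : 0 < t.toReal := ENNReal.toReal_pos ht0 ht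
  have hlow : ∀ (K : ℤ) x, ‖𝓕⁻ (lowFreq m g K) x‖ ≤ t.toReal * (a / (a - 1)) * a ^ K := by
    intro K x
    refine hm.norm_fourierInv_lowFreq_le hg ha hB.le (fun k => ?_) K
    have := h k x
    rw [← ENNReal.ofReal_toReal ht, ← ENNReal.ofReal_mul hB.le, ← ofReal_norm] at this
    exact (ENNReal.ofReal_le_ofReal_iff (by positivity)).1 this
  have hpt : ∀ᵐ x, ‖F x‖ₑ ^ r ≤ ∑' K : ℤ,
      ENNReal.ofReal (4 * (2 * (t.toReal * (a / (a - 1))) * a ^ (K + 1)) ^ (r - 2)) *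
        ‖fourierInvL2 (hv K) x‖ₑ ^ 2 := by
    filter_upwards [ae_all_iff.2 hF] with x hx
    exact enorm_rpow_le_tsum_of_forall_eq_add hr ha (by positivity) hx fun K => hlow K x
  -- The weights are multiples of `(2 ^ (2 * s)) ^ K` because `(d / r) * (r - 2) = 2 * s`.
  have hcoef : ∀ K : ℤ, 4 * (2 * (t.toReal * (a / (a - 1))) * a ^ (K + 1)) ^ (r - 2) =
      4 * (2 * (a / (a - 1)) * a) ^ (r - 2) * t.toReal ^ (r - 2) * (2 ^ (2 * s)) ^ K := by
    intro K
    have e1 : (2 * (t.toReal * (a / (a - 1))) * a ^ (K + 1)) =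
        2 * (a / (a - 1)) * a * t.toReal * a ^ K := by
      rw [zpow_add_one₀ ha0.ne']; ring
    have e2 : (a ^ K) ^ (r - 2) = (2 ^ (2 * s)) ^ K := by
      rw [← Real.rpow_intCast, ← Real.rpow_intCast, ha_def, ← Real.rpow_mul zero_le_two,
        ← Real.rpow_mul zero_le_two, ← Real.rpow_mul zero_le_two]
      congr 1
      field_simp at hrs ⊢
      linear_combination (-K : ℝ) * hrs
    rw [e1, Real.mul_rpow (by positivity) (by positivity),
      Real.mul_rpow (by positivity) (by positivity), e2]
    ring
  refine (lintegral_mono_ae hpt).trans ?_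
  rw [lintegral_tsum fun K =>
    ((memLp_fourierInvL2 (hv K)).aestronglyMeasurable.enorm.pow_const 2).const_mul _]
  simp only [lintegral_const_mul' _ _ ENNReal.ofReal_ne_top, ← eLpNorm_two_sq,
    eLpNorm_fourierInvL2, hcoef]
  have hsplit : ∀ K : ℤ, ENNReal.ofReal
      (4 * (2 * (a / (a - 1)) * a) ^ (r - 2) * t.toReal ^ (r - 2) * (2 ^ (2 * s)) ^ K) =
      ENNReal.ofReal (4 * (2 * (a / (a - 1)) * a) ^ (r - 2)) * t ^ (r - 2) *
        ENNReal.ofReal ((2 ^ (2 * s)) ^ K) := by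
    intro K
    rw [ENNReal.ofReal_mul (by positivity), ENNReal.ofReal_mul (by positivity),
      ← ENNReal.ofReal_rpow_of_pos hB, ENNReal.ofReal_toReal ht]
  simp only [hsplit, mul_assoc (ENNReal.ofReal (4 * _) * _), ENNReal.tsum_mul_left]
  refine (mul_le_mul_right (hm.tsum_eLpNorm_highFreq_le hg hs) _).trans (le_of_eq ?_)
  rw [sobolevConst, homSobolevNorm]
  ring

/-- Cauchy–Schwarz on the annulus `‖ξ‖ ≈ 2 ^ k` bounds the Besov norm by the Sobolev norm. -/
theorem IsLowCutoff.enorm_lpPiece_le_homSobolevNorm {d : ℕ} [NeZero d] {r s M : ℝ} (hr : 0 < r)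
    (hs : 0 ≤ s) (hrs : 1 / r + s / (d : ℝ) = 1 / 2) {m : EuclideanSpace ℝ (Fin d) → ℝ}
    {g : EuclideanSpace ℝ (Fin d) → ℂ} (hm : IsLowCutoff M m) (hg : LocallyIntegrable g volume)
    (k : ℤ) (x : EuclideanSpace ℝ (Fin d)) :
    ‖lpPiece (fun ξ => m ξ - m ((2 : ℝ) • ξ)) g k x‖ₑ ≤
      ENNReal.ofReal (2 * M * 2 ^ s) * (ENNReal.ofReal (2 ^ d) *
        volume (Metric.closedBall (0 : EuclideanSpace ℝ (Fin d)) 1)) ^ (1 / 2 : ℝ) *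
        homSobolevNorm s g * ENNReal.ofReal ((2 ^ ((d : ℝ) / r)) ^ k) := by
  have hd : (0 : ℝ) < d := Nat.cast_pos.2 (NeZero.pos d)
  have hM := hm.nonneg
  set S := Metric.closedBall (0 : EuclideanSpace ℝ (Fin d)) (2 ^ (k + 1)) with hS
  set w : EuclideanSpace ℝ (Fin d) → ℂ := fun ξ => ((‖ξ‖ ^ s : ℝ) : ℂ) * g ξ with hw
  have hwm : AEStronglyMeasurable w volume :=
    (by fun_prop : Measurable fun ξ : EuclideanSpace ℝ (Fin d) =>
      ((‖ξ‖ ^ s : ℝ) : ℂ)).aestronglyMeasurable.mul hg.aestronglyMeasurable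
  have hpt : ∀ ξ, ‖((m (((2 : ℝ) ^ (-k)) • ξ) - m ((2 : ℝ) • ((2 : ℝ) ^ (-k)) • ξ) : ℝ) : ℂ) *
      g ξ‖ₑ ≤
      ENNReal.ofReal (2 * M * 2 ^ s * (2 ^ (-s)) ^ k) * S.indicator (fun ξ => ‖w ξ‖ₑ) ξ := by
    intro ξ
    have hn := norm_two_zpow_neg_smul k ξ
    have hn2 : ‖(2 : ℝ) • ((2 : ℝ) ^ (-k)) • ξ‖ = 2 * (‖ξ‖ / 2 ^ k) := by
      rw [norm_smul, hn]; simp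
    have hpos : (0 : ℝ) < 2 ^ k := by positivity
    by_cases h2 : ξ ∈ S
    · rw [Set.indicator_of_mem h2, ← ofReal_norm, ← ofReal_norm,
        ← ENNReal.ofReal_mul (by positivity)]
      apply ENNReal.ofReal_le_ofReal
      rw [norm_mul, hw]
      simp only
      rw [norm_mul, Complex.norm_real, Complex.norm_real,
        Real.norm_of_nonneg (by positivity : 0 ≤ ‖ξ‖ ^ s), ← mul_assoc]
      gcongr
      -- Below the annulus both values of `m` are `1`; on it, `‖ξ‖ ^ s ≥ 2 ^ (s * (k - 1))`.
      rcases le_or_gt (2 * (‖ξ‖ / 2 ^ k)) 1 with h1 | h1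
      · rw [hm.eq_one _ (hn2.trans_le h1), hm.eq_one, sub_self, norm_zero]
        · positivity
        · rw [hn]
          have : 0 ≤ ‖ξ‖ / 2 ^ k := by positivity
          linarith
      · have h3 : (1 : ℝ) ≤ 2 ^ s * (2 ^ (-s)) ^ k * ‖ξ‖ ^ s := by
          have e : (2 : ℝ) ^ s * (2 ^ (-s)) ^ k * ‖ξ‖ ^ s = (2 * (‖ξ‖ / 2 ^ k)) ^ s := by
            rw [Real.mul_rpow (by norm_num) (by positivity), Real.div_rpow (by positivity)
              (by positivity), Real.rpow_neg (by norm_num), inv_zpow, ← Real.rpow_intCast,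
              ← Real.rpow_intCast, ← Real.rpow_mul (by norm_num), ← Real.rpow_mul (by norm_num),
              mul_comm s]
            field_simp
          rw [e]
          exact Real.one_le_rpow h1.le hs
        calc _ ≤ M + M := (norm_sub_le _ _).trans (add_le_add (hm.abs_le _) (hm.abs_le _))
          _ = 2 * M * 1 := by ring
          _ ≤ 2 * M * (2 ^ s * (2 ^ (-s)) ^ k * ‖ξ‖ ^ s) := by gcongr
          _ = _ := by ring
    · have hlt : (2 : ℝ) < ‖ξ‖ / 2 ^ k := by
        rw [lt_div_iff₀ hpos]
        simpa [hS, zpow_add_one₀ (two_ne_zero (α := ℝ)), mul_comm] using h2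
      rw [hm.eq_zero _ (hn ▸ hlt), hm.eq_zero _ (by rw [hn2]; linarith)]
      simp
  have hvol : volume S = ENNReal.ofReal ((2 ^ d) ^ k) * (ENNReal.ofReal (2 ^ d) *
      volume (Metric.closedBall (0 : EuclideanSpace ℝ (Fin d)) 1)) := by
    rw [hS, Measure.addHaar_closedBall' _ _ (by positivity), finrank_euclideanSpace_fin,
      ← mul_assoc, ← ENNReal.ofReal_mul (by positivity)]
    congr 2
    rw [zpow_add_one₀ two_ne_zero, mul_pow, ← zpow_natCast, ← zpow_natCast (2 : ℝ) d, ← zpow_mul,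
      ← zpow_mul, mul_comm k]
  have hCS : ∫⁻ ξ in S, ‖w ξ‖ₑ ≤ homSobolevNorm s g * volume S ^ (1 / 2 : ℝ) := by
    have := eLpNorm_le_eLpNorm_mul_rpow_measure_univ (μ := volume.restrict S) (p := 1) (q := 2)
      (by norm_num) hwm.restrict
    rw [eLpNorm_one_eq_lintegral_enorm, Measure.restrict_apply_univ] at this
    refine this.trans ?_
    rw [homSobolevNorm, show 1 / ENNReal.toReal 1 - 1 / ENNReal.toReal 2 = (1 / 2 : ℝ) by norm_num]
    gcongr
    exact Measure.restrict_le_self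
  have hfour : ∀ v : EuclideanSpace ℝ (Fin d) → ℂ, ‖𝓕⁻ v x‖ₑ ≤ ∫⁻ ξ, ‖v ξ‖ₑ := by
    intro v
    rw [Real.fourierInv_eq]
    refine (enorm_integral_le_lintegral_enorm _).trans (le_of_eq ?_)
    simp only [← ofReal_norm, Circle.norm_smul]
  rw [lpPiece]
  refine (hfour _).trans ((lintegral_mono hpt).trans ?_)
  rw [lintegral_const_mul' _ _ ENNReal.ofReal_ne_top,
    lintegral_indicator Metric.isClosed_closedBall.measurableSet]
  refine (mul_le_mul_right hCS _).trans (le_of_eq ?_)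
  have hexp : (2 ^ (-s)) ^ k * ((2 ^ d) ^ k) ^ (1 / 2 : ℝ) = ((2 : ℝ) ^ ((d : ℝ) / r)) ^ k := by
    rw [← Real.rpow_intCast, ← Real.rpow_intCast, ← Real.rpow_intCast, ← Real.rpow_natCast,
      ← Real.rpow_mul (by norm_num), ← Real.rpow_mul (by norm_num), ← Real.rpow_mul (by norm_num),
      ← Real.rpow_mul (by norm_num), ← Real.rpow_add (by norm_num)]
    congr 1
    field_simp at hrs ⊢
    linear_combination (-k : ℝ) * hrs
  rw [hvol, ENNReal.mul_rpow_of_nonneg _ _ (by norm_num), ← hexp,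
    ENNReal.ofReal_mul (p := 2 * M * 2 ^ s) (by positivity),
    ENNReal.ofReal_mul (p := (2 ^ (-s)) ^ k) (by positivity),
    ENNReal.ofReal_rpow_of_pos (by positivity)]
  ring

/-! ### The refined Sobolev inequality -/

/-- Only one function can represent `f`, so the splittings into low and high frequencies at
different scales give the same function. -/
theorem IsLowCutoff.exists_isRepresentedBy {d : ℕ} {s M : ℝ} (hs : 0 ≤ s)
    {m : EuclideanSpace ℝ (Fin d) → ℝ} (hm : IsLowCutoff M m)
    {f : 𝓢'(EuclideanSpace ℝ (Fin d), ℂ)} {g : EuclideanSpace ℝ (Fin d) → ℂ}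
    (hfg : IsRepresentedBy (𝓕 f) g) (hN : homSobolevNorm s g < ⊤) :
    ∃ (F : EuclideanSpace ℝ (Fin d) → ℂ) (hv : ∀ K, MemLp (highFreq m g K) 2 volume),
      IsRepresentedBy f F ∧ AEStronglyMeasurable F volume ∧
        ∀ K, F =ᵐ[volume] fun x => 𝓕⁻ (lowFreq m g K) x + fourierInvL2 (hv K) x := by
  have hg := hfg.locallyIntegrable
  have hv := hm.memLp_highFreq hg hs hN
  have hrep : ∀ K, IsRepresentedBy f
      (fun x => 𝓕⁻ (lowFreq m g K) x + fourierInvL2 (hv K) x) := fun K =>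
    hfg.fourierInv_add (hm.integrable_lowFreq hg K) (hv K)
      (.of_forall fun ξ => by simp only [lowFreq, highFreq]; ring)
  exact ⟨_, hv, hrep 0, (hrep 0).locallyIntegrable.aestronglyMeasurable,
    fun K => (hrep 0).ae_eq (hrep K)⟩

theorem exists_schwartzMap_fourier_eq_one (d : ℕ) :
    ∃ h : 𝓢(EuclideanSpace ℝ (Fin d), ℂ), ∀ ξ, ‖ξ‖ ≤ 2 →
      𝓕 (h : EuclideanSpace ℝ (Fin d) → ℂ) ξ = 1 := by
  let b : ContDiffBump (0 : EuclideanSpace ℝ (Fin d)) := ⟨2, 3, by norm_num, by norm_num⟩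
  have hc : HasCompactSupport (fun y => ((b y : ℝ) : ℂ)) :=
    b.hasCompactSupport.comp_left (g := fun t : ℝ => (t : ℂ)) (by simp)
  have hd : ContDiff ℝ ∞ (fun y => ((b y : ℝ) : ℂ)) :=
    Complex.ofRealCLM.contDiff.comp b.contDiff
  refine ⟨𝓕⁻ (hc.toSchwartzMap hd), fun ξ hξ => ?_⟩
  have h1 : b ξ = 1 := b.one_of_mem_closedBall (mem_closedBall_zero_iff.2 hξ)
  rw [← SchwartzMap.fourier_coe, FourierTransform.fourier_fourierInv_eq]
  simp [h1]

/-- Bernstein's inequality for the Littlewood–Paley pieces. -/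
theorem IsLowCutoff.exists_enorm_lpPiece_le {d : ℕ} {r M : ℝ} (hr : 1 < r)
    {m : EuclideanSpace ℝ (Fin d) → ℝ} (hm : IsLowCutoff M m) :
    ∃ C : ℝ≥0∞, C ≠ ⊤ ∧ ∀ (g : EuclideanSpace ℝ (Fin d) → ℂ), LocallyIntegrable g volume →
      ∀ k x, ‖lpPiece (fun ξ => m ξ - m ((2 : ℝ) • ξ)) g k x‖ₑ ≤
        C * eLpNorm (lpPiece (fun ξ => m ξ - m ((2 : ℝ) • ξ)) g k) (ENNReal.ofReal r) volume *
          ENNReal.ofReal ((2 ^ ((d : ℝ) / r)) ^ k) := by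
  obtain ⟨h, hh⟩ := exists_schwartzMap_fourier_eq_one d
  refine ⟨eLpNorm h (ENNReal.ofReal r.conjExponent) volume,
    (h.memLp _ volume).eLpNorm_ne_top, fun g hg k x => ?_⟩
  rw [lpPiece_sub_eq]
  have hpq := Real.HolderConjugate.conjExponent hr
  refine (enorm_fourierInv_le_eLpNorm h.integrable
    ((hm.integrable_lowFreq hg k).sub (hm.integrable_lowFreq hg (k - 1)))
    (by positivity : (0 : ℝ) < 2 ^ k) ?_ hpq x).trans (le_of_eq ?_)
  · intro ξ
    rcases le_or_gt ‖ξ‖ ((2 : ℝ) ^ (k + 1)) with hξ | hξ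
    · rw [hh, one_mul]
      rw [← zpow_neg, norm_two_zpow_neg_smul, div_le_iff₀ (by positivity)]
      rwa [zpow_add_one₀ two_ne_zero, mul_comm] at hξ
    · rw [Pi.sub_apply, hm.lowFreq_eq_zero hξ, hm.lowFreq_eq_zero, sub_zero, mul_zero]
      refine lt_of_le_of_lt ?_ hξ
      gcongr
      · norm_num
      · omega
  · have : ENNReal.ofReal (((2 : ℝ) ^ k) ^ d) ^ (1 / r) =
        ENNReal.ofReal ((2 ^ ((d : ℝ) / r)) ^ k) := by
      rw [ENNReal.ofReal_rpow_of_pos (by positivity), ← Real.rpow_intCast, ← Real.rpow_intCast,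
        ← Real.rpow_natCast, ← Real.rpow_mul zero_le_two, ← Real.rpow_mul zero_le_two,
        ← Real.rpow_mul zero_le_two]
      congr 2
      ring
    rw [finrank_euclideanSpace_fin, this]
    ring

/-- The refined Sobolev inequality for `s > 0` and pieces cut out by `m ξ - m (2 ξ)`. -/
theorem IsLowCutoff.exists_eLpNorm_le {d : ℕ} [NeZero d] {r s M : ℝ} (hr : 1 < r) (hs : 0 < s)
    (hrs : 1 / r + s / (d : ℝ) = 1 / 2) {m : EuclideanSpace ℝ (Fin d) → ℝ}
    (hm : IsLowCutoff M m) :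
    ∃ C : ℝ≥0, ∀ (f : 𝓢'(EuclideanSpace ℝ (Fin d), ℂ)) (g : EuclideanSpace ℝ (Fin d) → ℂ),
      IsRepresentedBy (𝓕 f) g → homSobolevNorm s g < (⊤ : ℝ≥0∞) →
      ∃ F : EuclideanSpace ℝ (Fin d) → ℂ,
        IsRepresentedBy f F ∧ MemLp F (ENNReal.ofReal r) volume ∧
        eLpNorm F (ENNReal.ofReal r) volume ≤
          (C : ℝ≥0∞) * homSobolevNorm s g ^ (1 - 2 * s / (d : ℝ)) *
            (⨆ k : ℤ, eLpNorm (lpPiece (fun ξ => m ξ - m ((2 : ℝ) • ξ)) g k)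
              (ENNReal.ofReal r) volume) ^ (2 * s / (d : ℝ)) := by
  have hd : (0 : ℝ) < d := Nat.cast_pos.2 (NeZero.pos d)
  have hr0 : 0 < r := by linarith
  have hr2 : 2 < r := by
    have : 0 < s / d := by positivity
    have : 1 / r < 1 / 2 := by linarith
    exact (one_div_lt_one_div hr0 two_pos).1 this
  have hθ : 0 < 2 * s / (d : ℝ) := by positivity
  have hθ1 : 1 - 2 * s / (d : ℝ) = 2 / r := by
    linear_combination (-2 : ℝ) * hrs
  have hθ2 : 2 * s / (d : ℝ) = (r - 2) / r := by
    rw [sub_div, div_self hr0.ne']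
    linear_combination (-1 : ℝ) * hθ1
  obtain ⟨C₁, hC₁, hbern⟩ := hm.exists_enorm_lpPiece_le hr
  set A := sobolevConst d r s M ^ (1 / r) with hA
  have hAtop : A ≠ ⊤ := ENNReal.rpow_ne_top_of_nonneg (by positivity) (sobolevConst_ne_top hs)
  -- The summand `1` makes the constant positive, so that the bound is trivial when the supremum
  -- is infinite.
  have hCtop : A * C₁ ^ (2 * s / (d : ℝ)) + 1 ≠ ⊤ := ENNReal.add_ne_top.2
    ⟨ENNReal.mul_ne_top hAtop (ENNReal.rpow_ne_top_of_nonneg hθ.le hC₁), ENNReal.one_ne_top⟩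
  refine ⟨(A * C₁ ^ (2 * s / (d : ℝ)) + 1).toNNReal, fun f g hfg hN => ?_⟩
  rw [ENNReal.coe_toNNReal hCtop]
  have hg := hfg.locallyIntegrable
  obtain ⟨F, hv, hF, hFm, hsplit⟩ := hm.exists_isRepresentedBy hs.le hfg hN
  set N := homSobolevNorm s g with hNdef
  have hNe : N ^ (2 / r) ≠ ⊤ := ENNReal.rpow_ne_top_of_nonneg (by positivity) hN.ne
  have key : ∀ t : ℝ≥0∞, t ≠ 0 → t ≠ ⊤ →
      (∀ k x, ‖lpPiece (fun ξ => m ξ - m ((2 : ℝ) • ξ)) g k x‖ₑ ≤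
        t * ENNReal.ofReal ((2 ^ ((d : ℝ) / r)) ^ k)) →
      eLpNorm F (ENNReal.ofReal r) volume ≤ A * N ^ (2 / r) * t ^ ((r - 2) / r) := by
    intro t ht0 ht h
    rw [eLpNorm_eq_lintegral_rpow_enorm_toReal (by simpa using hr0) ENNReal.ofReal_ne_top,
      ENNReal.toReal_ofReal hr0.le]
    refine (ENNReal.rpow_le_rpow (hm.lintegral_rpow_le hr2 hs hrs hg hv hsplit ht0 ht h)
      (by positivity : 0 ≤ 1 / r)).trans (le_of_eq ?_)
    rw [ENNReal.mul_rpow_of_nonneg _ _ (by positivity),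
      ENNReal.mul_rpow_of_nonneg _ _ (by positivity), ← ENNReal.rpow_mul, ← ENNReal.rpow_natCast,
      ← ENNReal.rpow_mul, hA]
    rw [show (r - 2) * (1 / r) = (r - 2) / r by ring,
      show ((2 : ℕ) : ℝ) * (1 / r) = 2 / r by push_cast; ring]
    ring
  set S := ⨆ k : ℤ, eLpNorm (lpPiece (fun ξ => m ξ - m ((2 : ℝ) • ξ)) g k)
    (ENNReal.ofReal r) volume with hS
  obtain ⟨t₀, ht₀, ht₀', hbound⟩ : ∃ t : ℝ≥0∞, t ≠ 0 ∧ t ≠ ⊤ ∧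
      ∀ k x, ‖lpPiece (fun ξ => m ξ - m ((2 : ℝ) • ξ)) g k x‖ₑ ≤
        t * ENNReal.ofReal ((2 ^ ((d : ℝ) / r)) ^ k) := by
    refine ⟨ENNReal.ofReal (2 * M * 2 ^ s) * (ENNReal.ofReal (2 ^ d) *
      volume (Metric.closedBall (0 : EuclideanSpace ℝ (Fin d)) 1)) ^ (1 / 2 : ℝ) * N + 1,
      by simp, ?_, fun k x => ?_⟩
    · have hvol : volume (Metric.closedBall (0 : EuclideanSpace ℝ (Fin d)) 1) ≠ ⊤ :=
        measure_closedBall_lt_top.ne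
      finiteness
    · refine (hm.enorm_lpPiece_le_homSobolevNorm hr0 hs.le hrs hg k x).trans ?_
      gcongr
      exact le_self_add
  have hfin := key t₀ ht₀ ht₀' hbound
  refine ⟨F, hF, ⟨hFm, hfin.trans_lt ?_⟩, ?_⟩
  · have : t₀ ^ ((r - 2) / r) ≠ ⊤ := ENNReal.rpow_ne_top_of_nonneg (hθ2 ▸ hθ.le) ht₀'
    exact (ENNReal.mul_ne_top (ENNReal.mul_ne_top hAtop hNe) this).lt_top
  rw [hθ1]
  rcases eq_or_ne S ⊤ with hS' | hS'
  · rcases eq_or_ne N 0 with hN0 | hN0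
    · rw [hN0, ENNReal.zero_rpow_of_pos (by positivity), mul_zero, zero_mul] at hfin
      exact hfin.trans zero_le
    · rw [hS', ENNReal.top_rpow_of_pos hθ, ENNReal.mul_top]
      · exact le_top
      · refine mul_ne_zero (by simp) ?_
        rw [Ne, ENNReal.rpow_eq_zero_iff]
        push Not
        exact ⟨fun h => absurd h hN0, fun h => absurd h hN.ne⟩
  · have hlt : C₁ * S < ⊤ := (ENNReal.mul_ne_top hC₁ hS').lt_top
    -- Approaching `C₁ * S` from above covers the case `S = 0` as well.
    have hlim : Tendsto (fun t : ℝ≥0∞ => A * N ^ (2 / r) * t ^ ((r - 2) / r))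
        (𝓝[>] (C₁ * S)) (𝓝 (A * N ^ (2 / r) * (C₁ * S) ^ ((r - 2) / r))) :=
      ((ENNReal.Tendsto.const_mul (ENNReal.continuous_rpow_const.tendsto _)
        (Or.inr (ENNReal.mul_ne_top hAtop hNe))).mono_left nhdsWithin_le_nhds)
    have : (𝓝[>] (C₁ * S)).NeBot := nhdsGT_neBot_of_exists_gt ⟨⊤, hlt⟩
    have hle : eLpNorm F (ENNReal.ofReal r) volume ≤
        A * N ^ (2 / r) * (C₁ * S) ^ ((r - 2) / r) := by
      refine ge_of_tendsto hlim ?_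
      filter_upwards [Ioo_mem_nhdsGT hlt] with t ht
      refine key t (pos_of_gt ht.1).ne' ht.2.ne fun k x => (hbern g hg k x).trans ?_
      gcongr
      exact le_trans (by gcongr; exact le_iSup (fun k : ℤ => eLpNorm (lpPiece
        (fun ξ => m ξ - m ((2 : ℝ) • ξ)) g k) (ENNReal.ofReal r) volume) k) ht.1.le
    rw [hθ2]
    refine hle.trans ?_
    rw [ENNReal.mul_rpow_of_nonneg _ _ (hθ2 ▸ hθ.le)]
    calc _ = A * C₁ ^ ((r - 2) / r) * N ^ (2 / r) * S ^ ((r - 2) / r) := by ring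
      _ ≤ _ := by
        gcongr
        exact le_self_add

theorem isLowCutoff_indicator (d : ℕ) : IsLowCutoff 1
    (Set.indicator {ξ : EuclideanSpace ℝ (Fin d) | ‖ξ‖ ≤ 2} fun _ => (1 : ℝ)) where
  measurable := measurable_const.indicator (measurableSet_le measurable_norm measurable_const)
  abs_le ξ := by
    by_cases h : ‖ξ‖ ≤ 2 <;> simp [Set.indicator, h]
  eq_one ξ h := Set.indicator_of_mem (s := {ξ | ‖ξ‖ ≤ 2}) (h.trans one_le_two) _
  eq_zero ξ h := Set.indicator_of_notMem (s := {ξ | ‖ξ‖ ≤ 2}) (not_le.2 h) _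

/-- The sharp cut-off differs from `m ξ - m (2 ξ)`, where `m` is the indicator function of
`‖ξ‖ ≤ 2`, only on the null set `‖ξ‖ = 1`. -/
theorem lpPiece_sharpCutoff {d : ℕ} [NeZero d] (g : EuclideanSpace ℝ (Fin d) → ℂ) (k : ℤ) :
    lpPiece (sharpCutoff d) g k = lpPiece (fun ξ =>
      Set.indicator {ξ : EuclideanSpace ℝ (Fin d) | ‖ξ‖ ≤ 2} (fun _ => (1 : ℝ)) ξ -
      Set.indicator {ξ : EuclideanSpace ℝ (Fin d) | ‖ξ‖ ≤ 2} (fun _ => (1 : ℝ)) ((2 : ℝ) • ξ))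
        g k := by
  ext x
  rw [lpPiece, lpPiece, Real.fourierInv_eq, Real.fourierInv_eq]
  refine integral_congr_ae ?_
  have hnull : ∀ᵐ ξ : EuclideanSpace ℝ (Fin d), ‖ξ‖ ≠ 2 ^ k := by
    have := Measure.addHaar_sphere (volume : Measure (EuclideanSpace ℝ (Fin d))) 0 ((2 : ℝ) ^ k)
    rw [ae_iff]
    convert this using 2
    ext ξ
    simp
  filter_upwards [hnull] with ξ hξ
  have hne : ‖((2 : ℝ) ^ (-k)) • ξ‖ ≠ 1 := by
    rwa [norm_two_zpow_neg_smul, Ne, div_eq_one_iff_eq (by positivity)]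
  generalize ((2 : ℝ) ^ (-k)) • ξ = ζ at hne
  have : sharpCutoff d ζ =
      Set.indicator {ξ : EuclideanSpace ℝ (Fin d) | ‖ξ‖ ≤ 2} (fun _ => (1 : ℝ)) ζ -
      Set.indicator {ξ : EuclideanSpace ℝ (Fin d) | ‖ξ‖ ≤ 2} (fun _ => (1 : ℝ)) ((2 : ℝ) • ζ) := by
    simp only [sharpCutoff, Set.indicator, Set.mem_ofPred_eq, norm_smul, Real.norm_ofNat]
    rcases lt_or_gt_of_ne hne with h | h
    · rw [if_neg (by intro h'; linarith [h'.1]), if_pos (by linarith), if_pos (by linarith),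
        sub_self]
    · rw [if_neg (show ¬ 2 * ‖ζ‖ ≤ 2 by linarith), sub_zero]
      congr 1
      simp [h.le]
  simp only [this]

theorem exists_isLowCutoff_of_contDiff {d : ℕ} {η : EuclideanSpace ℝ (Fin d) → ℝ}
    (hη : ContDiff ℝ ∞ η) (h1 : ∀ ξ, ‖ξ‖ ≤ 1 → η ξ = 1) (h0 : ∀ ξ, 2 ≤ ‖ξ‖ → η ξ = 0) :
    ∃ M, IsLowCutoff M η := by
  have hc : HasCompactSupport η := by
    refine HasCompactSupport.of_support_subset_isCompact (isCompact_closedBall 0 2) fun ξ hξ => ?_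
    rw [mem_closedBall_zero_iff]
    by_contra h
    exact hξ (h0 ξ (not_le.1 h).le)
  obtain ⟨M, hM⟩ := hc.exists_bound_of_continuous hη.continuous
  exact ⟨M, hη.continuous.measurable, hM, h1, fun ξ h => h0 ξ h.le⟩

theorem mainTheorem7 (d : ℕ) (hd : 1 ≤ d) (r s : ℝ) (hr : 1 < r) (hs : 0 ≤ s)
    (hrs : 1 / r + s / (d : ℝ) = 1 / 2)
    (ψ : EuclideanSpace ℝ (Fin d) → ℝ) (hψ : ψ = sharpCutoff d ∨ IsSmoothCutoff ψ) :
    ∃ C : ℝ≥0, ∀ (f : 𝓢'(EuclideanSpace ℝ (Fin d), ℂ)) (fhat : EuclideanSpace ℝ (Fin d) → ℂ),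
      IsRepresentedBy (𝓕 f) fhat → homSobolevNorm s fhat < (⊤ : ℝ≥0∞) →
      ∃ F : EuclideanSpace ℝ (Fin d) → ℂ,
        IsRepresentedBy f F ∧ MemLp F (ENNReal.ofReal r) volume ∧
        eLpNorm F (ENNReal.ofReal r) volume ≤
          (C : ℝ≥0∞) * homSobolevNorm s fhat ^ (1 - 2 * s / (d : ℝ)) *
            (⨆ k : ℤ, eLpNorm (lpPiece ψ fhat k) (ENNReal.ofReal r) volume)
              ^ (2 * s / (d : ℝ)) := by
  have : NeZero d := ⟨by omega⟩
  rcases hs.eq_or_lt with rfl | hs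
  · -- For `s = 0` one has `r = 2`, and the claim is Plancherel's theorem.
    obtain rfl : r = 2 := by
      rw [zero_div, add_zero, one_div, one_div, inv_inj] at hrs
      exact hrs
    refine ⟨1, fun f g hfg hN => ?_⟩
    have hN' : homSobolevNorm 0 g = eLpNorm g 2 volume := by simp [homSobolevNorm]
    have hv : MemLp g 2 volume := ⟨hfg.locallyIntegrable.aestronglyMeasurable, hN' ▸ hN⟩
    have h := hfg.fourierInv_add (integrable_zero _ _ _) hv (.of_forall fun ξ => (zero_add _).symm)
    have h0 : ∀ x, 𝓕⁻ (0 : EuclideanSpace ℝ (Fin d) → ℂ) x = 0 := fun x => by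
      simp [Real.fourierInv_eq]
    simp only [h0, zero_add] at h
    refine ⟨_, h, by simpa using memLp_fourierInvL2 hv, ?_⟩
    simp [hN', eLpNorm_fourierInvL2]
  · rcases hψ with rfl | ⟨η, hη, h1, h0, hψ⟩
    · simp only [lpPiece_sharpCutoff]
      exact (isLowCutoff_indicator d).exists_eLpNorm_le hr hs hrs
    · obtain ⟨M, hM⟩ := exists_isLowCutoff_of_contDiff hη h1 h0
      obtain rfl : ψ = fun ξ => η ξ - η ((2 : ℝ) • ξ) := funext hψ
      exact hM.exists_eLpNorm_le hr hs hrs
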